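/- Let $P$ be a set with a reflexive and symmetric relation $\mathcal C$ (the concurrency relation). A labelled heap is a triple $(E,\le,\varepsilon)$, where $(E,\le)$ is a finite (possibly empty) partially ordered set and $\varepsilon:E\to P$ is a map such that any $a,b\in E$ with $\varepsilon(a)\,\mathcal C\,\varepsilon(b)$ are comparable, and $\le$ is the transitive closure of the relation "$a\le b$ and $\varepsilon(a)\,\mathcal C\,\varepsilon(b)$". A heap is an isomorphism class of labelled heaps (isomorphisms of posets preserving labels), and $H(P,\mathcal C)$ is the set of heaps. It is a monoid under superposition: $E\circ F$ has as underlying set the disjoint union of $E$ and $F$, with the given labels, and its order is the transitive closure of the orders of $E$ and of $F$ together with all pairs $(a,b)$ with $a\in E$, $b\in F$, $\varepsilon(a)\,\mathcal C\,\varepsilon(b)$; the identity is the empty heap. For a subset $F\subseteq E$, the corresponding subheap is $F$ with the restricted labels and the order that is the transitive closure on $F$ of the relation "$a\le b$ and $\varepsilon(a)\,\mathcal C\,\varepsilon(b)$". A chain $x_1<\cdots<x_t$ in $E$ is convex if every $y\in E$ with $x_i<y<x_j$ for some $i,j$ belongs to the chain, and balanced if $\varepsilon(x_1)=\varepsilon(x_t)$.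 For a balanced convex chain $\mathbf c$, the contraction $E/\mathbf c$ is the subheap of $E$ obtained by omitting $x_2,\dots,x_t$. A heap has property P2 if it contains no convex chain of the form $x<z$ or $x<y<z$ with $\varepsilon(x)=\varepsilon(z)$. Let $\mathcal A=\mathbb Z[v,v^{-1}]$ and $\delta=v+v^{-1}$, and let $\mathcal A H(P,\mathcal C)$ be the monoid algebra of the heap monoid over $\mathcal A$. Let $Q$ be the quotient of $\mathcal A H(P,\mathcal C)$ by the two-sided ideal generated by the relations $$E=\delta\,E/\mathbf c\quad\text{if } \mathbf c \text{ is a balanced convex chain of length } 2 \text{ in } E,$$ $$E=E/\mathbf c\quad\text{if } \mathbf c \text{ is a balanced convex chain } x<y<z \text{ in } E \text{ with } \varepsilon(x)\ne\varepsilon(y).$$ Proposition. $Q$ is a free $\mathcal A$-module, and the images in $Q$ of the heaps in $H(P,\mathcal C)$ with property P2 (distinct heaps having distinct images) form an $\mathcal A$-basis of $Q$. -/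

import Mathlib

universe u

/-- A concurrency relation on a set `P` of pieces: a reflexive and symmetric relation. -/
structure ConcurrencyRel (P : Type u) where
  rel : P → P → Prop
  refl : ∀ p, rel p p
  symm : ∀ p q, rel p q → rel q p

/-- A labelled heap with pieces in `P` and concurrency relation `C`: a finite (possibly empty)
partially ordered set with a labelling in `P`, in which elements with concurrent labels are
comparable, and whose order is the transitive closure of its restriction to the pairs of elements
with concurrent labels. (The heaps will be isomorphism classes of these, so it is enough to have
carriers in `Type`.) -/
structure LabelledHeap {P : Type u} (C : ConcurrencyRel P) where
  carrier : Type
  [fin : Finite carrier]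
  [order : PartialOrder carrier]
  label : carrier → P
  comparable : ∀ a b : carrier, C.rel (label a) (label b) → a ≤ b ∨ b ≤ a
  le_iff : ∀ a b : carrier, a ≤ b ↔
    Relation.TransGen (fun x y => x ≤ y ∧ C.rel (label x) (label y)) a b

namespace LabelledHeap

variable {P : Type u} {C : ConcurrencyRel P}

instance (E : LabelledHeap C) : Finite E.carrier := E.fin

instance (E : LabelledHeap C) : PartialOrder E.carrier := E.order

/-- Isomorphism of labelled posets. -/
def Iso (E F : LabelledHeap C) : Prop :=
  ∃ φ : E.carrier ≃o F.carrier, ∀ x, F.label (φ x) = E.label x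

theorem Iso.refl (E : LabelledHeap C) : Iso E E := ⟨OrderIso.refl _, fun _ => rfl⟩

theorem Iso.symm {E F : LabelledHeap C} : Iso E F → Iso F E := by
  rintro ⟨φ, h⟩
  exact ⟨φ.symm, fun x => by rw [← h, OrderIso.apply_symm_apply]⟩

theorem Iso.trans {E F G : LabelledHeap C} : Iso E F → Iso F G → Iso E G := by
  rintro ⟨φ, h⟩ ⟨ψ, k⟩
  exact ⟨φ.trans ψ, fun x => by rw [OrderIso.trans_apply, k, h]⟩

instance setoid (C : ConcurrencyRel P) : Setoid (LabelledHeap C) where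
  r := Iso
  iseqv := ⟨Iso.refl, Iso.symm, Iso.trans⟩

/-! ### Subheaps -/

/-- The generating relation of the order of the subheap with vertex set `s`. -/
def subRel (E : LabelledHeap C) (s : Set E.carrier) (a b : s) : Prop :=
  (a : E.carrier) ≤ b ∧ C.rel (E.label a) (E.label b)

theorem subRel_closure_le (E : LabelledHeap C) (s : Set E.carrier) {a b : s}
    (h : Relation.TransGen (E.subRel s) a b) : (a : E.carrier) ≤ b := by
  induction h with
  | single h => exact h.1
  | tail _ h ih => exact ih.trans h.1

/-- The order of the subheap with vertex set `s`. -/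
@[reducible]
def subOrder (E : LabelledHeap C) (s : Set E.carrier) : PartialOrder s where
  le := Relation.TransGen (E.subRel s)
  lt a b := Relation.TransGen (E.subRel s) a b ∧ ¬ Relation.TransGen (E.subRel s) b a
  lt_iff_le_not_ge _ _ := Iff.rfl
  le_refl _ := .single ⟨le_rfl, C.refl _⟩
  le_trans _ _ _ := Relation.TransGen.trans
  le_antisymm _ _ h k :=
    Subtype.ext (le_antisymm (E.subRel_closure_le s h) (E.subRel_closure_le s k))

/-- The subheap of `E` with vertex set `s`: its order is the transitive closure of the relation
`a ≤ b` and `a`, `b` have concurrent labels, on `s`. It may be weaker than the order that `s`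
inherits from `E`. -/
def subheap (E : LabelledHeap C) (s : Set E.carrier) : LabelledHeap C :=
  { carrier := s
    order := E.subOrder s
    label := fun a => E.label a
    comparable := fun a b h => (E.comparable a b h).imp
      (fun k => .single ⟨k, h⟩)
      (fun k => .single ⟨k, C.symm _ _ h⟩)
    le_iff := fun a b => by
      constructor
      · intro h
        exact Relation.TransGen.mono (r := E.subRel s)
          (fun _ _ k => ⟨Relation.TransGen.single k, k.2⟩) a b h
      · intro h
        induction h with
        | single h => exact h.1
        | tail _ h ih => exact Relation.TransGen.trans ih h.1 }

/-! ### Superposition -/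

/-- The generating relation of the order of the superposition of `E` over `F`. -/
def supRel (E F : LabelledHeap C) : E.carrier ⊕ F.carrier → E.carrier ⊕ F.carrier → Prop
  | .inl a, .inl b => a ≤ b
  | .inr a, .inr b => a ≤ b
  | .inl a, .inr b => C.rel (E.label a) (F.label b)
  | .inr _, .inl _ => False

/-- An explicit description of the transitive closure of `supRel`. -/
def supLe (E F : LabelledHeap C) : E.carrier ⊕ F.carrier → E.carrier ⊕ F.carrier → Prop
  | .inl a, .inl b => a ≤ b
  | .inr a, .inr b => a ≤ b
  | .inl a, .inr b => ∃ a' b', a ≤ a' ∧ C.rel (E.label a') (F.label b') ∧ b' ≤ b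
  | .inr _, .inl _ => False

theorem supRel_closure (E F : LabelledHeap C) (x y : E.carrier ⊕ F.carrier) :
    Relation.TransGen (supRel E F) x y ↔ supLe E F x y := by
  constructor
  · intro h
    induction h with
    | @single y h =>
      rcases x with a | a <;> rcases y with b | b
      · exact h
      · exact ⟨a, b, le_rfl, h, le_rfl⟩
      · exact h
      · exact h
    | @tail y z _ h ih =>
      rcases x with a | a <;> rcases y with b | b <;> rcases z with c | c
      · exact le_trans ih h
      · exact ⟨b, c, ih, h, le_rfl⟩
      · exact h.elim
      · obtain ⟨a', b', h1, h2, h3⟩ := ih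
        exact ⟨a', b', h1, h2, h3.trans h⟩
      · exact ih.elim
      · exact ih.elim
      · exact h.elim
      · exact le_trans ih h
  · intro h
    rcases x with a | a <;> rcases y with b | b
    · exact .single h
    · obtain ⟨a', b', h1, h2, h3⟩ := h
      exact .tail (.tail (.single (b := Sum.inl a') h1) (c := Sum.inr b') h2) h3
    · exact h.elim
    · exact .single h

/-- The order of the superposition. -/
@[reducible]
def supOrder (E F : LabelledHeap C) : PartialOrder (E.carrier ⊕ F.carrier) where
  le := Relation.TransGen (supRel E F)
  lt a b := Relation.TransGen (supRel E F) a b ∧ ¬ Relation.TransGen (supRel E F) b a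
  lt_iff_le_not_ge _ _ := Iff.rfl
  le_refl a := .single (by cases a <;> exact le_rfl)
  le_trans _ _ _ := Relation.TransGen.trans
  le_antisymm x y h k := by
    rw [supRel_closure] at h k
    rcases x with a | a <;> rcases y with b | b
    · exact congrArg _ (le_antisymm h k)
    · exact k.elim
    · exact h.elim
    · exact congrArg _ (le_antisymm h k)

/-- The superposition of `E` over `F`: the disjoint union, ordered by the transitive closure of
`supRel`. -/
def sup (E F : LabelledHeap C) : LabelledHeap C :=
  { carrier := E.carrier ⊕ F.carrier
    order := supOrder E F
    label := Sum.elim E.label F.label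
    comparable := fun x y h => by
      rcases x with a | a <;> rcases y with b | b
      · exact (E.comparable a b h).imp (fun k => .single k) (fun k => .single k)
      · exact Or.inl (.single h)
      · exact Or.inr (.single (C.symm _ _ h))
      · exact (F.comparable a b h).imp (fun k => .single k) (fun k => .single k)
    le_iff := fun x y => by
      constructor
      · intro h
        change Relation.TransGen (supRel E F) x y at h
        refine Relation.TransGen.trans_induction_on h ?_ (fun _ _ => Relation.TransGen.trans)
        intro x y h
        rcases x with a | a <;> rcases y with b | b
        · exact Relation.TransGen.lift (r := fun x y => x ≤ y ∧ C.rel (E.label x) (E.label y))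
            Sum.inl (fun _ _ k => ⟨.single k.1, k.2⟩) a b ((E.le_iff a b).1 h)
        · exact .single ⟨.single h, h⟩
        · exact h.elim
        · exact Relation.TransGen.lift (r := fun x y => x ≤ y ∧ C.rel (F.label x) (F.label y))
            Sum.inr (fun _ _ k => ⟨.single k.1, k.2⟩) a b ((F.le_iff a b).1 h)
      · intro h
        induction h with
        | single h => exact h.1
        | tail _ h ih => exact Relation.TransGen.trans ih h.1 }

theorem sup_le_iff (E F : LabelledHeap C) (x y : E.carrier ⊕ F.carrier) :
    (sup E F).order.le x y ↔ supLe E F x y := supRel_closure E F x y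

theorem sup_congr {E E' F F' : LabelledHeap C} (h : Iso E E') (k : Iso F F') :
    Iso (sup E F) (sup E' F') := by
  obtain ⟨φ, hφ⟩ := h
  obtain ⟨ψ, hψ⟩ := k
  refine ⟨⟨Equiv.sumCongr φ.toEquiv ψ.toEquiv, ?_⟩, ?_⟩
  · intro x y
    refine (sup_le_iff E' F' _ _).trans (Iff.trans ?_ (sup_le_iff E F x y).symm)
    rcases x with a | a <;> rcases y with b | b
    · exact φ.le_iff_le
    · constructor
      · rintro ⟨a', b', h1, h2, h3⟩
        refine ⟨φ.symm a', ψ.symm b', ?_, ?_, ?_⟩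
        · rw [OrderIso.le_symm_apply]; exact h1
        · rw [← hφ, ← hψ, OrderIso.apply_symm_apply, OrderIso.apply_symm_apply]; exact h2
        · rw [OrderIso.symm_apply_le]; exact h3
      · rintro ⟨a', b', h1, h2, h3⟩
        exact ⟨φ a', ψ b', φ.le_iff_le.2 h1, by rw [hφ, hψ]; exact h2, ψ.le_iff_le.2 h3⟩
    · exact Iff.rfl
    · exact ψ.le_iff_le
  · rintro (a | a)
    · exact hφ a
    · exact hψ a

theorem sup_assoc_iso (E F G : LabelledHeap C) :
    Iso (sup (sup E F) G) (sup E (sup F G)) := by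
  refine ⟨⟨Equiv.sumAssoc E.carrier F.carrier G.carrier, ?_⟩, ?_⟩
  · intro x y
    refine (sup_le_iff E (sup F G) _ _).trans
      (Iff.trans ?_ (sup_le_iff (sup E F) G x y).symm)
    rcases x with (a | a) | a <;> rcases y with (b | b) | b
    · exact (sup_le_iff E F (.inl a) (.inl b)).symm
    · refine Iff.trans ?_ (sup_le_iff E F (.inl a) (.inr b)).symm
      constructor
      · rintro ⟨a', b' | b', h1, h2, h3⟩
        · exact ⟨a', b', h1, h2, (sup_le_iff F G _ _).1 h3⟩
        · exact ((sup_le_iff F G _ _).1 h3).elim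
      · rintro ⟨a', b', h1, h2, h3⟩
        exact ⟨a', .inl b', h1, h2, (sup_le_iff F G (.inl b') (.inl b)).2 h3⟩
    · constructor
      · rintro ⟨a', b' | b', h1, h2, h3⟩
        · obtain ⟨c, d, k1, k2, k3⟩ := (sup_le_iff F G _ _).1 h3
          exact ⟨.inr c, d, (sup_le_iff E F (.inl a) (.inr c)).2 ⟨a', b', h1, h2, k1⟩, k2, k3⟩
        · exact ⟨.inl a', b', (sup_le_iff E F (.inl a) (.inl a')).2 h1, h2,
            (sup_le_iff F G _ _).1 h3⟩
      · rintro ⟨a' | a', b', h1, h2, h3⟩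
        · exact ⟨a', .inr b', (sup_le_iff E F _ _).1 h1, h2,
            (sup_le_iff F G (.inr b') (.inr b)).2 h3⟩
        · obtain ⟨c, d, k1, k2, k3⟩ := (sup_le_iff E F _ _).1 h1
          exact ⟨c, .inl d, k1, k2,
            (sup_le_iff F G (.inl d) (.inr b)).2 ⟨a', b', k3, h2, h3⟩⟩
    · exact (sup_le_iff E F (.inr a) (.inl b)).symm
    · exact (sup_le_iff F G (.inl a) (.inl b)).trans (sup_le_iff E F (.inr a) (.inr b)).symm
    · refine (sup_le_iff F G (.inl a) (.inr b)).trans ?_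
      constructor
      · rintro ⟨a', b', h1, h2, h3⟩
        exact ⟨.inr a', b', (sup_le_iff E F (.inr a) (.inr a')).2 h1, h2, h3⟩
      · rintro ⟨a' | a', b', h1, h2, h3⟩
        · exact ((sup_le_iff E F _ _).1 h1).elim
        · exact ⟨a', b', (sup_le_iff E F _ _).1 h1, h2, h3⟩
    · exact Iff.rfl
    · exact sup_le_iff F G (.inr a) (.inl b)
    · exact sup_le_iff F G (.inr a) (.inr b)
  · rintro ((a | a) | a) <;> rfl

/-- The empty labelled heap. -/
def empty (C : ConcurrencyRel P) : LabelledHeap C where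
  carrier := PEmpty
  label := PEmpty.elim
  comparable := fun a => a.elim
  le_iff := fun a => a.elim

theorem empty_sup_iso (E : LabelledHeap C) : Iso (sup (empty C) E) E := by
  refine ⟨⟨Equiv.emptySum PEmpty E.carrier, ?_⟩, ?_⟩
  · rintro (a | a) (b | b)
    · exact a.elim
    · exact a.elim
    · exact b.elim
    · exact (sup_le_iff (empty C) E (.inr a) (.inr b)).symm
  · rintro (a | a)
    · exact a.elim
    · rfl

theorem sup_empty_iso (E : LabelledHeap C) : Iso (sup E (empty C)) E := by
  refine ⟨⟨Equiv.sumEmpty E.carrier PEmpty, ?_⟩, ?_⟩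
  · rintro (a | a) (b | b)
    · exact (sup_le_iff E (empty C) (.inl a) (.inl b)).symm
    · exact b.elim
    · exact a.elim
    · exact a.elim
  · rintro (a | a)
    · rfl
    · exact a.elim

/-! ### Convex chains, contraction and property P2 -/

/-- `c` lists, in increasing order, the members `x₁ < ⋯ < xₜ` of a convex chain. -/
def IsConvexChain (E : LabelledHeap C) (c : List E.carrier) : Prop :=
  c.Pairwise (· < ·) ∧ ∀ a ∈ c, ∀ b ∈ c, ∀ y, a < y → y < b → y ∈ c

/-- The chain `c` is balanced: its first and its last member have the same label. -/
def IsBalanced (E : LabelledHeap C) (c : List E.carrier) : Prop :=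
  c.head?.map E.label = c.getLast?.map E.label

/-- The contraction of `E` along the chain `c = (x₁, …, xₜ)`: the subheap obtained by omitting
`x₂, …, xₜ`. -/
def contract (E : LabelledHeap C) (c : List E.carrier) : LabelledHeap C :=
  E.subheap {y | y ∉ c.tail}

/-- Property P2: there are no convex chains `x < z` or `x < y < z` in which `x` and `z` have the
same label. -/
def HasP2 (E : LabelledHeap C) : Prop :=
  (∀ x z, E.IsConvexChain [x, z] → E.label x ≠ E.label z) ∧
    ∀ x y z, E.IsConvexChain [x, y, z] → E.label x ≠ E.label z

theorem IsConvexChain.map {E F : LabelledHeap C} (φ : E.carrier ≃o F.carrier)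
    {c : List E.carrier} (h : E.IsConvexChain c) : F.IsConvexChain (c.map φ) := by
  refine ⟨List.pairwise_map.2 (h.1.imp fun k => φ.lt_iff_lt.2 k), ?_⟩
  intro a' ha' b' hb' y hy hy'
  obtain ⟨a, ha, rfl⟩ := List.mem_map.1 ha'
  obtain ⟨b, hb, rfl⟩ := List.mem_map.1 hb'
  refine List.mem_map.2 ⟨φ.symm y, h.2 a ha b hb _ ?_ ?_, φ.apply_symm_apply y⟩
  · exact φ.lt_symm_apply.2 hy
  · exact φ.symm_apply_lt.2 hy'

theorem HasP2.of_iso {E F : LabelledHeap C} (h : Iso F E) (hE : E.HasP2) : F.HasP2 := by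
  obtain ⟨φ, hφ⟩ := h
  refine ⟨fun x z k => ?_, fun x y z k => ?_⟩
  · rw [← hφ, ← hφ]; exact hE.1 _ _ (k.map φ)
  · rw [← hφ, ← hφ]; exact hE.2 _ _ _ (k.map φ)

end LabelledHeap

/-- The set `H(P, C)` of heaps: labelled heaps up to isomorphism of labelled posets. -/
def Heap {P : Type u} (C : ConcurrencyRel P) : Type (max u 1) :=
  Quotient (LabelledHeap.setoid C)

namespace Heap

variable {P : Type u} {C : ConcurrencyRel P}

/-- The heap `[E]` represented by the labelled heap `E`. -/
def mk (E : LabelledHeap C) : Heap C := Quotient.mk _ E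

/-- The heap monoid: multiplication is superposition. -/
instance : Monoid (Heap C) where
  mul := Quotient.map₂ LabelledHeap.sup fun _ _ h _ _ k => LabelledHeap.sup_congr h k
  one := mk (LabelledHeap.empty C)
  mul_assoc := by
    rintro ⟨E⟩ ⟨F⟩ ⟨G⟩
    exact Quotient.sound (LabelledHeap.sup_assoc_iso E F G)
  one_mul := by
    rintro ⟨E⟩
    exact Quotient.sound (LabelledHeap.empty_sup_iso E)
  mul_one := by
    rintro ⟨E⟩
    exact Quotient.sound (LabelledHeap.sup_empty_iso E)

/-- Property P2 for heaps. -/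
def HasP2 : Heap C → Prop :=
  Quotient.lift LabelledHeap.HasP2 fun _ _ h =>
    propext ⟨LabelledHeap.HasP2.of_iso h.symm, LabelledHeap.HasP2.of_iso h⟩

end Heap

noncomputable section

/-- The element `δ = v + v⁻¹` of `ℤ[v, v⁻¹]`. -/
def heapDelta : LaurentPolynomial ℤ := LaurentPolynomial.T 1 + LaurentPolynomial.T (-1)

/-- The heap monoid algebra over `ℤ[v, v⁻¹]`. -/
abbrev HeapAlgebra {P : Type u} (C : ConcurrencyRel P) : Type (max u 1) :=
  MonoidAlgebra (LaurentPolynomial ℤ) (Heap C)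

/-- A heap as an element of the heap monoid algebra. -/
def heapOf {P : Type u} {C : ConcurrencyRel P} (h : Heap C) : HeapAlgebra C :=
  MonoidAlgebra.of (LaurentPolynomial ℤ) (Heap C) h

/-- The defining relations of the quotient: `E = δ E/c` for the balanced convex chains `c` of
length 2, and `E = E/c` for the balanced convex chains `c : x < y < z` in which the label of `y`
is not that of `x`. -/
inductive HeapRelation {P : Type u} (C : ConcurrencyRel P) :
    HeapAlgebra C → HeapAlgebra C → Prop
  | two (E : LabelledHeap C) (x y : E.carrier) (hc : E.IsConvexChain [x, y])
      (hb : E.IsBalanced [x, y]) :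
      HeapRelation C (heapOf (Heap.mk E)) (heapDelta • heapOf (Heap.mk (E.contract [x, y])))
  | three (E : LabelledHeap C) (x y z : E.carrier) (hc : E.IsConvexChain [x, y, z])
      (hb : E.IsBalanced [x, y, z]) (hne : E.label x ≠ E.label y) :
      HeapRelation C (heapOf (Heap.mk E)) (heapOf (Heap.mk (E.contract [x, y, z])))

/-- The quotient of the heap monoid algebra by the two-sided ideal generated by the defining
relations. -/
abbrev HeapQuotient {P : Type u} (C : ConcurrencyRel P) : Type (max u 1) :=
  RingQuot (HeapRelation C)

/-- The image of a heap in the quotient. -/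
def heapImage {P : Type u} {C : ConcurrencyRel P} (h : Heap C) : HeapQuotient C :=
  RingQuot.mkAlgHom (LaurentPolynomial ℤ) (HeapRelation C) (heapOf h)

end

/-! Orient the two relations from left to right and rewrite pairs `(n, h)` standing for `δ ^ n h`,
so that every step takes a single pair to a single pair. Each step removes vertices, so rewriting
terminates, and the irreducible heaps are exactly those with property P2. The content is that two
steps from the same pair can be rejoined, after at most one further step on each side. Church–Rosser
then gives unique normal forms `δ ^ n h` with `h` of property P2.

For the rejoining, note that a contraction may equally well delete the bottom of the chain and keep
its top, since both have the same label and nothing that survives lies between them. When two chains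
meet, one can therefore usually choose the deleted ends so that each chain avoids what the other
deletes; the steps then commute (`Joinable.of_disjoint`). Apart from coinciding steps, two
configurations escape this: two triples that overlap in two elements, where suitable choices delete
the same set, and two triples with a common middle, where each contraction turns the other chain
into a balanced pair and both sides gain one factor `δ`.

Spanning is then immediate. For independence, the normal form gives a linear map from the monoid
algebra to the free module on heaps with P2. Steps are stable under superposition on both sides, so
this map kills the two-sided ideal, and it fixes the candidate basis. No property of `δ` is used. -/

namespace LabelledHeap

variable {P : Type u} {C : ConcurrencyRel P}

/-! ### Isomorphisms and subheaps -/

/-- Two labelled heaps are isomorphic as soon as there is a label preserving bijection that is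
monotone on pairs with concurrent labels. -/
theorem Iso.of_equiv {E F : LabelledHeap C} (φ : E.carrier ≃ F.carrier)
    (hl : ∀ x, F.label (φ x) = E.label x)
    (hm : ∀ a b, C.rel (E.label a) (E.label b) → a ≤ b → φ a ≤ φ b) : Iso E F := by
  refine ⟨⟨φ, ?_⟩, hl⟩
  -- Concurrent elements are comparable in `E`, so by antisymmetry in `F` monotonicity already
  -- forces order reflection on such pairs.
  have key : ∀ a b, C.rel (E.label a) (E.label b) → φ a ≤ φ b → a ≤ b := by
    intro a b h k
    rcases E.comparable a b h with h1 | h1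
    · exact h1
    · have := hm b a (C.symm _ _ h) h1
      exact (φ.injective (le_antisymm k this)).le
  intro a b
  constructor
  · intro h
    have h2 := (F.le_iff _ _).1 h
    rw [E.le_iff]
    have := Relation.TransGen.lift (p := fun x y => x ≤ y ∧ C.rel (E.label x) (E.label y))
      φ.symm (fun x y (k : x ≤ y ∧ C.rel (F.label x) (F.label y)) => by
        have h3 : C.rel (E.label (φ.symm x)) (E.label (φ.symm y)) := by
          rw [← hl, ← hl, φ.apply_symm_apply, φ.apply_symm_apply]; exact k.2
        exact ⟨key _ _ h3 (by rw [φ.apply_symm_apply, φ.apply_symm_apply]; exact k.1), h3⟩) _ _ h2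
    simpa [Function.onFun] using this
  · intro h
    rw [E.le_iff] at h
    exact (F.le_iff _ _).2 (Relation.TransGen.lift φ (fun x y k =>
      ⟨hm x y k.2 k.1, by rw [hl, hl]; exact k.2⟩) _ _ h)

section Subheap

variable (E : LabelledHeap C) (s : Set E.carrier)

/-- The inclusion of a subheap. -/
def incl : (E.subheap s).carrier → E.carrier := Subtype.val

variable {E s}

theorem incl_injective : Function.Injective (E.incl s) := Subtype.val_injective

theorem incl_mem (a : (E.subheap s).carrier) : E.incl s a ∈ s := Subtype.property a

theorem exists_incl {a : E.carrier} (h : a ∈ s) : ∃ b, E.incl s b = a := ⟨⟨a, h⟩, rfl⟩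

theorem range_incl : Set.range (E.incl s) = s := Subtype.range_val

theorem label_incl (a : (E.subheap s).carrier) : E.label (E.incl s a) = (E.subheap s).label a :=
  rfl

theorem incl_mono {a b : (E.subheap s).carrier} (h : a ≤ b) : E.incl s a ≤ E.incl s b :=
  E.subRel_closure_le s h

theorem incl_strictMono {a b : (E.subheap s).carrier} (h : a < b) :
    E.incl s a < E.incl s b :=
  lt_of_le_of_ne (incl_mono h.le) fun k => h.ne (incl_injective k)

/-- The order of a subheap may be weaker than the induced one, so the inclusion reflects the order
only on concurrent pairs in general. -/
theorem le_of_incl_le {a b : (E.subheap s).carrier}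
    (hc : C.rel ((E.subheap s).label a) ((E.subheap s).label b))
    (h : E.incl s a ≤ E.incl s b) : a ≤ b :=
  Relation.TransGen.single ⟨h, hc⟩

theorem lt_of_incl_lt {a b : (E.subheap s).carrier}
    (hc : C.rel ((E.subheap s).label a) ((E.subheap s).label b))
    (h : E.incl s a < E.incl s b) : a < b :=
  lt_of_le_of_ne (le_of_incl_le hc h.le) fun k => h.ne (congrArg _ k)

/-- A labelled heap that embeds in `E` with image `s` is isomorphic to the subheap on `s`. -/
theorem Iso.subheap_of_embedding {F : LabelledHeap C} (f : F.carrier → E.carrier)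
    (hf : Function.Injective f) (hr : Set.range f = s) (hl : ∀ a, E.label (f a) = F.label a)
    (hm : ∀ a b, C.rel (F.label a) (F.label b) → a ≤ b → f a ≤ f b) :
    Iso F (E.subheap s) := by
  subst hr
  refine Iso.of_equiv (F := E.subheap (Set.range f)) (Equiv.ofInjective f hf) hl ?_
  intro a b h k
  refine le_of_incl_le ?_ (hm a b h k)
  change C.rel (E.label (f a)) (E.label (f b))
  rwa [hl, hl]

theorem subheap_subheap_iso (t : Set (E.subheap s).carrier) :
    Iso ((E.subheap s).subheap t) (E.subheap (E.incl s '' t)) := by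
  refine Iso.subheap_of_embedding (fun a => E.incl s ((E.subheap s).incl t a))
    (incl_injective.comp incl_injective) ?_ (fun _ => rfl) fun a b _ h => incl_mono (incl_mono h)
  rw [← Function.comp_def, Set.range_comp, range_incl]

theorem subheap_iso_of_iso {F : LabelledHeap C} (φ : E.carrier ≃o F.carrier)
    (hφ : ∀ x, F.label (φ x) = E.label x) : Iso (E.subheap s) (F.subheap (φ '' s)) := by
  refine Iso.subheap_of_embedding (fun a => φ (E.incl s a))
    (φ.injective.comp incl_injective) ?_ (fun _ => hφ _)
    fun a b _ h => φ.monotone (incl_mono h)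
  rw [← Function.comp_def (f := φ), Set.range_comp, range_incl]

/-- If two elements `x < z` with the same label have no element of `s` between them, then they may
be exchanged. -/
theorem subheap_insert_iso {x z : E.carrier} (hxz : x < z) (hl : E.label x = E.label z)
    (hx : x ∉ s) (hz : z ∉ s) (h : ∀ w ∈ s, x < w → ¬ w < z) :
    Iso (E.subheap (insert z s)) (E.subheap (insert x s)) := by
  classical
  have hmem : ∀ a : (E.subheap (insert z s)).carrier, E.incl _ a = z ∨ E.incl _ a ∈ s :=
    fun a => incl_mem a
  refine Iso.subheap_of_embedding (F := E.subheap (insert z s))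
    (fun a => if E.incl _ a = z then x else E.incl _ a) ?_ ?_ ?_ ?_
  · intro a b hab
    have ha := hmem a
    have hb := hmem b
    apply incl_injective
    dsimp only at hab
    split_ifs at hab with h1 h2 h2
    · rw [h1, h2]
    · rw [hab] at hx; tauto
    · rw [← hab] at hx; tauto
    · exact hab
  · ext w
    constructor
    · rintro ⟨a, rfl⟩
      have ha := hmem a
      dsimp only
      split_ifs with h1
      · exact Set.mem_insert _ _
      · exact Set.mem_insert_of_mem _ (ha.resolve_left h1)
    · rintro (rfl | hw)
      · obtain ⟨a, ha⟩ := exists_incl (E := E) (Set.mem_insert z s)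
        exact ⟨a, if_pos ha⟩
      · obtain ⟨a, rfl⟩ := exists_incl (E := E) (Set.mem_insert_of_mem z hw)
        refine ⟨a, if_neg ?_⟩
        rintro k
        exact hz (k ▸ hw)
  · intro a
    rw [← label_incl]
    split_ifs with h1
    · rw [hl, h1]
    · rfl
  · intro a b hc hab
    have hab := incl_mono hab
    rw [← label_incl, ← label_incl] at hc
    have ha := hmem a
    split_ifs with h1 h2 h2
    · exact le_rfl
    · exact hxz.le.trans (h1.ge.trans hab)
    -- Here `b` is `z`. As `x` and `z` share a label, the other element is comparable with `x`; were
    -- it above `x`, it would lie in `s` strictly between `x` and `z`.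
    · rw [h2] at hab hc
      rcases E.comparable (E.incl _ a) x (hl ▸ hc) with k | k
      · exact k
      · have ha' := ha.resolve_left h1
        refine absurd (lt_of_le_of_ne hab h1) (h _ ha' (lt_of_le_of_ne k ?_))
        rintro rfl
        exact hx ha'
    · exact hab

end Subheap

/-! ### Convex chains of two and three elements -/

section Chain

variable {E : LabelledHeap C}

theorem isConvexChain_pair {x y : E.carrier} :
    E.IsConvexChain [x, y] ↔ x < y ∧ ∀ w, x < w → ¬ w < y := by
  simp only [IsConvexChain, List.pairwise_cons, List.mem_cons, List.not_mem_nil, or_false,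
    forall_eq_or_imp, forall_eq]
  constructor
  · rintro ⟨⟨h, -⟩, ⟨-, h2⟩, -⟩
    refine ⟨h, fun w h3 h4 => ?_⟩
    rcases h2 w h3 h4 with rfl | rfl
    · exact lt_irrefl _ h3
    · exact lt_irrefl _ h4
  · rintro ⟨h, h2⟩
    refine ⟨⟨h, by simp⟩, ⟨fun w h3 h4 => (lt_asymm h3 h4).elim,
      fun w h3 h4 => (h2 w h3 h4).elim⟩, fun w h3 h4 => ?_, fun w h3 h4 => (lt_asymm h3 h4).elim⟩
    exact (lt_asymm h (h3.trans h4)).elim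

theorem isConvexChain_triple {x y z : E.carrier} :
    E.IsConvexChain [x, y, z] ↔ x < y ∧ y < z ∧ ∀ w, x < w → w < z → w = y := by
  simp only [IsConvexChain, List.pairwise_cons, List.mem_cons, List.not_mem_nil, or_false,
    forall_eq_or_imp, forall_eq]
  constructor
  · rintro ⟨⟨⟨h, -⟩, h1, -⟩, ⟨-, -, h2⟩, -⟩
    refine ⟨h, h1, fun w h3 h4 => ?_⟩
    rcases h2 w h3 h4 with rfl | rfl | rfl
    · exact (lt_irrefl _ h3).elim
    · rfl
    · exact (lt_irrefl _ h4).elim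
  · rintro ⟨h, h1, h2⟩
    refine ⟨⟨⟨h, h.trans h1⟩, h1, by simp⟩, ⟨?_, ?_, ?_⟩, ⟨?_, ?_, ?_⟩, ?_, ?_, ?_⟩ <;>
      intro w h3 h4
    · exact (lt_asymm h3 h4).elim
    · exact .inr (.inl (h2 w h3 (h4.trans h1)))
    · exact .inr (.inl (h2 w h3 h4))
    · exact (lt_asymm h (h3.trans h4)).elim
    · exact (lt_asymm h3 h4).elim
    · exact .inr (.inl (h2 w (h.trans h3) h4))
    · exact (lt_asymm (h.trans h1) (h3.trans h4)).elim
    · exact (lt_asymm h1 (h3.trans h4)).elim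
    · exact (lt_asymm h3 h4).elim

/-- The labels of two consecutive elements are concurrent. -/
theorem rel_of_covBy {x y : E.carrier} (hxy : x < y) (h : ∀ w, x < w → ¬ w < y) :
    C.rel (E.label x) (E.label y) := by
  have := (E.le_iff x y).1 hxy.le
  -- In a sequence of concurrent comparabilities from `x` to `y`, nothing lies strictly between, so
  -- the first link that moves goes straight to `y`.
  induction this using Relation.TransGen.head_induction_on with
  | single k => exact k.2
  | @head a b k k' ih =>
    have hb : b ≤ y := (E.le_iff _ _).2 k'
    rcases eq_or_lt_of_le k.1 with rfl | k1
    · exact ih hxy h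
    · rcases eq_or_lt_of_le hb with rfl | k2
      · exact k.2
      · exact (h b k1 k2).elim

end Chain

end LabelledHeap

namespace LabelledHeap

variable {P : Type u} {C : ConcurrencyRel P}

/-! ### Chains and contractions under superposition -/

section Transport

variable {E F : LabelledHeap C}

/-- An injective map with order convex image which preserves and reflects the order maps convex
chains to convex chains. -/
theorem IsConvexChain.map_of_convex (f : E.carrier → F.carrier) (hf : ∀ a b, f a < f b ↔ a < b)
    (hc : ∀ a b y, f a < y → y < f b → y ∈ Set.range f) {c : List E.carrier}
    (h : E.IsConvexChain c) : F.IsConvexChain (c.map f) := by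
  refine ⟨List.pairwise_map.2 (h.1.imp fun k => (hf _ _).2 k), ?_⟩
  intro a' ha' b' hb' y hy hy'
  obtain ⟨a, ha, rfl⟩ := List.mem_map.1 ha'
  obtain ⟨b, hb, rfl⟩ := List.mem_map.1 hb'
  obtain ⟨w, rfl⟩ := hc a b y hy hy'
  exact List.mem_map.2 ⟨w, h.2 a ha b hb w ((hf _ _).1 hy) ((hf _ _).1 hy'), rfl⟩

theorem IsConvexChain.inl {c : List E.carrier} (h : E.IsConvexChain c) :
    (sup E F).IsConvexChain (c.map Sum.inl) := by
  have hle : ∀ x y : (sup E F).carrier, x ≤ y ↔ supLe E F x y := sup_le_iff E F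
  refine h.map_of_convex (F := sup E F) Sum.inl ?_ ?_
  · intro a b
    refine lt_iff_le_not_ge.trans (Iff.trans ?_ lt_iff_le_not_ge.symm)
    exact and_congr (hle _ _) (not_congr (hle _ _))
  · rintro a b (y | y) h1 h2
    · exact ⟨y, rfl⟩
    · exact ((hle _ _).1 h2.le).elim

theorem IsConvexChain.inr {c : List F.carrier} (h : F.IsConvexChain c) :
    (sup E F).IsConvexChain (c.map Sum.inr) := by
  have hle : ∀ x y : (sup E F).carrier, x ≤ y ↔ supLe E F x y := sup_le_iff E F
  refine h.map_of_convex (F := sup E F) Sum.inr ?_ ?_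
  · intro a b
    refine lt_iff_le_not_ge.trans (Iff.trans ?_ lt_iff_le_not_ge.symm)
    exact and_congr (hle _ _) (not_congr (hle _ _))
  · rintro a b (y | y) h1 h2
    · exact ((hle _ _).1 h1.le).elim
    · exact ⟨y, rfl⟩

theorem range_sumMap_left {α β γ : Type*} {f : γ → α} {c : List α}
    (hf : Set.range f = {y | y ∉ c.tail}) :
    Set.range (Sum.map f (id : β → β)) = {y | y ∉ (c.map Sum.inl).tail} := by
  ext (y | y)
  · rw [← List.map_tail]
    have := Set.ext_iff.1 hf y
    simpa [-List.map_tail, -List.mem_map,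
      List.mem_map_of_injective Sum.inl_injective] using this
  · cases c <;> simp

theorem range_sumMap_right {α β γ : Type*} {f : γ → β} {c : List β}
    (hf : Set.range f = {y | y ∉ c.tail}) :
    Set.range (Sum.map (id : α → α) f) = {y | y ∉ (c.map Sum.inr).tail} := by
  ext (y | y)
  · cases c <;> simp
  · rw [← List.map_tail]
    have := Set.ext_iff.1 hf y
    simpa [-List.map_tail, -List.mem_map,
      List.mem_map_of_injective Sum.inr_injective] using this

theorem sup_contract_left_iso (c : List E.carrier) :
    Iso (sup (E.contract c) F) ((sup E F).contract (c.map Sum.inl)) := by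
  refine Iso.subheap_of_embedding (E := sup E F)
    (Sum.map (E.incl _) id) (incl_injective.sumMap Function.injective_id) ?_ ?_ ?_
  · exact range_sumMap_left range_incl
  · rintro (a | a) <;> rfl
  · intro x y hc hxy
    refine (sup_le_iff _ _ _ _).2 ?_
    replace hxy := (sup_le_iff _ _ _ _).1 hxy
    rcases x with a | a <;> rcases y with b | b
    · exact incl_mono hxy
    · exact ⟨E.incl _ a, b, le_rfl, hc, le_rfl⟩
    · exact hxy
    · exact hxy

theorem sup_contract_right_iso (c : List F.carrier) :
    Iso (sup E (F.contract c)) ((sup E F).contract (c.map Sum.inr)) := by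
  refine Iso.subheap_of_embedding (E := sup E F)
    (Sum.map id (F.incl _)) (Function.injective_id.sumMap incl_injective) ?_ ?_ ?_
  · exact range_sumMap_right range_incl
  · rintro (a | a) <;> rfl
  · intro x y hc hxy
    refine (sup_le_iff _ _ _ _).2 ?_
    replace hxy := (sup_le_iff _ _ _ _).1 hxy
    rcases x with a | a <;> rcases y with b | b
    · exact hxy
    · exact ⟨a, F.incl _ b, le_rfl, hc, le_rfl⟩
    · exact hxy
    · exact incl_mono hxy

end Transport

/-! ### Reductions as deletions from either end -/

/-- `E.Removable c k D` says that `c` is the set of members of a balanced convex chain as in the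
defining relations, that the corresponding relation reads `E = δ ^ k E/c`, and that deleting `D`
from `E` gives `E/c` up to isomorphism. -/
inductive Removable (E : LabelledHeap C) : Set E.carrier → ℕ → Set E.carrier → Prop
  | two_bot (x y : E.carrier) (hc : E.IsConvexChain [x, y]) (hl : E.label x = E.label y) :
      Removable E {x, y} 1 {x}
  | two_top (x y : E.carrier) (hc : E.IsConvexChain [x, y]) (hl : E.label x = E.label y) :
      Removable E {x, y} 1 {y}
  | three_bot (x y z : E.carrier) (hc : E.IsConvexChain [x, y, z])
      (hl : E.label x = E.label z) (hne : E.label x ≠ E.label y) :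
      Removable E {x, y, z} 0 {x, y}
  | three_top (x y z : E.carrier) (hc : E.IsConvexChain [x, y, z])
      (hl : E.label x = E.label z) (hne : E.label x ≠ E.label y) :
      Removable E {x, y, z} 0 {y, z}

/-- A convex chain with consecutive concurrent labels that avoids the deleted elements remains
a convex chain. -/
theorem isConvexChain_subheap_pair {E : LabelledHeap C} {s : Set E.carrier}
    {x y : (E.subheap s).carrier} (h : E.IsConvexChain [E.incl s x, E.incl s y]) :
    (E.subheap s).IsConvexChain [x, y] := by
  rw [isConvexChain_pair] at h ⊢
  exact ⟨lt_of_incl_lt (rel_of_covBy (E := E) h.1 h.2 :) h.1,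
    fun w h1 h2 => h.2 _ (incl_strictMono h1) (incl_strictMono h2)⟩

theorem rel_of_triple {E : LabelledHeap C} {x y z : E.carrier} (h : E.IsConvexChain [x, y, z]) :
    C.rel (E.label x) (E.label y) ∧ C.rel (E.label y) (E.label z) := by
  rw [isConvexChain_triple] at h
  obtain ⟨h1, h2, h3⟩ := h
  exact ⟨rel_of_covBy h1 fun w k l => l.ne (h3 w k (l.trans h2)),
    rel_of_covBy h2 fun w k l => k.ne' (h3 w (h1.trans k) l)⟩

theorem isConvexChain_subheap_triple {E : LabelledHeap C} {s : Set E.carrier}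
    {x y z : (E.subheap s).carrier}
    (h : E.IsConvexChain [E.incl s x, E.incl s y, E.incl s z]) :
    (E.subheap s).IsConvexChain [x, y, z] := by
  have hr := rel_of_triple h
  rw [isConvexChain_triple] at h ⊢
  exact ⟨lt_of_incl_lt hr.1 h.1, lt_of_incl_lt hr.2 h.2.1,
    fun w h1 h2 => incl_injective (h.2.2 _ (incl_strictMono h1) (incl_strictMono h2))⟩

/-- Consecutive members of a convex chain are concurrent, so the chain stays a chain in any subheap
containing it; fewer vertices and a weaker order cannot spoil convexity. -/
theorem Removable.subheap {E : LabelledHeap C} {s c D : Set E.carrier} {k : ℕ}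
    (h : E.Removable c k D) (hs : c ⊆ s) :
    ∃ c' D', (E.subheap s).Removable c' k D' ∧ E.incl s '' D' = D := by
  cases h with
  | two_bot x y hc hl =>
    obtain ⟨x, rfl⟩ := exists_incl (hs (by simp) : x ∈ s)
    obtain ⟨y, rfl⟩ := exists_incl (hs (by simp) : y ∈ s)
    exact ⟨_, _, .two_bot x y (isConvexChain_subheap_pair hc) hl, by simp⟩
  | two_top x y hc hl =>
    obtain ⟨x, rfl⟩ := exists_incl (hs (by simp) : x ∈ s)
    obtain ⟨y, rfl⟩ := exists_incl (hs (by simp) : y ∈ s)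
    exact ⟨_, _, .two_top x y (isConvexChain_subheap_pair hc) hl, by simp⟩
  | three_bot x y z hc hl hne =>
    obtain ⟨x, rfl⟩ := exists_incl (hs (by simp) : x ∈ s)
    obtain ⟨y, rfl⟩ := exists_incl (hs (by simp) : y ∈ s)
    obtain ⟨z, rfl⟩ := exists_incl (hs (by simp) : z ∈ s)
    exact ⟨_, _, .three_bot x y z (isConvexChain_subheap_triple hc) hl hne,
      by simp [Set.image_pair]⟩
  | three_top x y z hc hl hne =>
    obtain ⟨x, rfl⟩ := exists_incl (hs (by simp) : x ∈ s)
    obtain ⟨y, rfl⟩ := exists_incl (hs (by simp) : y ∈ s)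
    obtain ⟨z, rfl⟩ := exists_incl (hs (by simp) : z ∈ s)
    exact ⟨_, _, .three_top x y z (isConvexChain_subheap_triple hc) hl hne,
      by simp [Set.image_pair]⟩

end LabelledHeap

/-! ### The rewriting system and commuting reductions -/

namespace Heap

open LabelledHeap

variable {P : Type u} {C : ConcurrencyRel P}

theorem mk_eq_mk {E F : LabelledHeap C} : mk E = mk F ↔ Iso E F := Quotient.eq

/-- One application of a defining relation, from left to right, to `δ ^ n h`, recorded as the pair
`(n, h)`. -/
inductive Step : ℕ × Heap C → ℕ × Heap C → Prop
  | two (n : ℕ) (E : LabelledHeap C) (x y : E.carrier) (hc : E.IsConvexChain [x, y])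
      (hl : E.label x = E.label y) : Step (n, mk E) (n + 1, mk (E.contract [x, y]))
  | three (n : ℕ) (E : LabelledHeap C) (x y z : E.carrier) (hc : E.IsConvexChain [x, y, z])
      (hl : E.label x = E.label z) (hne : E.label x ≠ E.label y) :
      Step (n, mk E) (n, mk (E.contract [x, y, z]))

theorem contract_pair (E : LabelledHeap C) (x y : E.carrier) :
    E.contract [x, y] = E.subheap {y}ᶜ := by
  unfold contract; congr 1; ext; simp

theorem contract_triple (E : LabelledHeap C) (x y z : E.carrier) :
    E.contract [x, y, z] = E.subheap {y, z}ᶜ := by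
  unfold contract; congr 1; ext; simp

/-- Either end of a balanced pair may be deleted. -/
theorem mk_subheap_bot_eq_top {E : LabelledHeap C} {x y : E.carrier}
    (hc : E.IsConvexChain [x, y]) (hl : E.label x = E.label y) :
    mk (E.subheap {x}ᶜ) = mk (E.subheap {y}ᶜ) := by
  rw [isConvexChain_pair] at hc
  have := subheap_insert_iso (s := {x, y}ᶜ) hc.1 hl (by simp) (by simp) fun w _ => hc.2 w
  convert mk_eq_mk.2 this using 3
  · ext w; by_cases h : w = y <;> simp [h, hc.1.ne']
  · ext w; by_cases h : w = x <;> simp [h, hc.1.ne]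

theorem mk_subheap_triple_bot_eq_top {E : LabelledHeap C} {x y z : E.carrier}
    (hc : E.IsConvexChain [x, y, z]) (hl : E.label x = E.label z) :
    mk (E.subheap {x, y}ᶜ) = mk (E.subheap {y, z}ᶜ) := by
  rw [isConvexChain_triple] at hc
  have hxz := hc.1.trans hc.2.1
  have := subheap_insert_iso (s := {x, y, z}ᶜ) hxz hl (by simp) (by simp)
    fun w hw h1 h2 => hw (by simp [hc.2.2 w h1 h2])
  convert mk_eq_mk.2 this using 3
  · ext w; by_cases h : w = z <;> simp [h, hc.2.1.ne', hxz.ne']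
  · ext w; by_cases h : w = x <;> simp [h, hc.1.ne, hxz.ne]

theorem Step.of_removable (n : ℕ) {E : LabelledHeap C} {c D : Set E.carrier} {k : ℕ}
    (h : E.Removable c k D) : Step (n, mk E) (n + k, mk (E.subheap Dᶜ)) := by
  cases h with
  | two_top x y hc hl => rw [← contract_pair E x]; exact .two n E x y hc hl
  | two_bot x y hc hl =>
    rw [mk_subheap_bot_eq_top hc hl, ← contract_pair E x]; exact .two n E x y hc hl
  | three_top x y z hc hl hne => rw [← contract_triple E x]; exact .three n E x y z hc hl hne
  | three_bot x y z hc hl hne =>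
    rw [mk_subheap_triple_bot_eq_top hc hl, ← contract_triple E x]
    exact .three n E x y z hc hl hne

theorem mk_subheap_image {E F : LabelledHeap C} {φ : E.carrier ≃o F.carrier}
    (hφ : ∀ x, F.label (φ x) = E.label x) (s : Set E.carrier) :
    mk (E.subheap sᶜ) = mk (F.subheap (φ '' s)ᶜ) := by
  rw [← Set.image_compl_eq φ.bijective]
  exact mk_eq_mk.2 (subheap_iso_of_iso φ hφ)

/-- All the reductions of a heap are seen on any of its representatives. -/
theorem Step.exists_chain {n : ℕ} {E : LabelledHeap C} {p : ℕ × Heap C}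
    (h : Step (n, mk E) p) :
    (∃ x y, E.IsConvexChain [x, y] ∧ E.label x = E.label y ∧
      p = (n + 1, mk (E.subheap {y}ᶜ))) ∨
    ∃ x y z, E.IsConvexChain [x, y, z] ∧ E.label x = E.label z ∧ E.label x ≠ E.label y ∧
      p = (n, mk (E.subheap {y, z}ᶜ)) := by
  generalize hq : (n, mk E) = q at h
  cases h with
  | two m F x y hc hl =>
    obtain ⟨rfl, h⟩ := Prod.mk.inj hq
    obtain ⟨φ, hφ⟩ := mk_eq_mk.1 h.symm
    refine .inl ⟨φ x, φ y, hc.map φ, by rw [hφ, hφ, hl], ?_⟩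
    rw [contract_pair, mk_subheap_image hφ, Set.image_singleton]
  | three m F x y z hc hl hne =>
    obtain ⟨rfl, h⟩ := Prod.mk.inj hq
    obtain ⟨φ, hφ⟩ := mk_eq_mk.1 h.symm
    refine .inr ⟨φ x, φ y, φ z, hc.map φ, by rw [hφ, hφ, hl], by rwa [hφ, hφ], ?_⟩
    rw [contract_triple, mk_subheap_image hφ, Set.image_pair]

/-- Two results of reductions that agree after at most one further reduction of each. -/
def Joinable (p q : ℕ × Heap C) : Prop :=
  ∃ d, Relation.ReflGen Step p d ∧ Relation.ReflGen Step q d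

theorem Joinable.symm {p q : ℕ × Heap C} (h : Joinable p q) : Joinable q p := by
  obtain ⟨d, h, k⟩ := h
  exact ⟨d, k, h⟩

theorem Joinable.of_eq {p q : ℕ × Heap C} (h : p = q) : Joinable p q :=
  ⟨q, h ▸ .refl, .refl⟩

/-- A reduction is still available after an unrelated deletion that misses its chain, and the two
deletions add up to deleting the union. -/
theorem Step.subheap_subheap (n : ℕ) {E : LabelledHeap C} {c D D' : Set E.carrier} {k : ℕ}
    (h : E.Removable c k D) (hd : Disjoint c D') :
    Step (n, mk (E.subheap D'ᶜ)) (n + k, mk (E.subheap (D ∪ D')ᶜ)) := by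
  obtain ⟨c', B, h1, h2⟩ := h.subheap (Set.subset_compl_iff_disjoint_right.2 hd)
  convert Step.of_removable n h1 using 2
  rw [mk_eq_mk.2 (subheap_subheap_iso _)]
  congr 2
  rw [← Set.range_sdiff_image incl_injective, h2, range_incl]
  ext w
  simp [and_comm]

/-- Reductions that do not interfere commute. -/
theorem Joinable.of_disjoint (n : ℕ) {E : LabelledHeap C} {c D c' D' : Set E.carrier} {k k' : ℕ}
    (h : E.Removable c k D) (h' : E.Removable c' k' D') (hd : Disjoint c D')
    (hd' : Disjoint c' D) :
    Joinable (n + k, mk (E.subheap Dᶜ)) (n + k', mk (E.subheap D'ᶜ)) := by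
  refine ⟨_, .single (Step.subheap_subheap (n + k) h' hd'), .single ?_⟩
  rw [Set.union_comm, add_right_comm]
  exact Step.subheap_subheap (n + k') h hd

end Heap

/-! ### Local confluence: overlapping chains -/

namespace Heap

open LabelledHeap

variable {P : Type u} {C : ConcurrencyRel P} {E : LabelledHeap C}

/-- Equal tops give equal results, because only the top is deleted. If the pairs are stacked at a
common element, that element is kept by both reductions. -/
theorem joinable_pair_pair (n : ℕ) {x y x' y' : E.carrier}
    (hc : E.IsConvexChain [x, y]) (hl : E.label x = E.label y)
    (hc' : E.IsConvexChain [x', y']) (hl' : E.label x' = E.label y') :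
    Joinable (n + 1, mk (E.subheap {y}ᶜ)) (n + 1, mk (E.subheap {y'}ᶜ)) := by
  have h := isConvexChain_pair.1 hc
  have h' := isConvexChain_pair.1 hc'
  by_cases h1 : y = y'
  · subst h1; exact .of_eq rfl
  by_cases h2 : y = x'
  · subst h2
    rw [← mk_subheap_bot_eq_top hc hl]
    refine .of_disjoint n (.two_bot x y hc hl) (.two_top y y' hc' hl') ?_ ?_
    · simp [h'.1.ne', (h.1.trans h'.1).ne']
    · simp [h.1.ne, (h.1.trans h'.1).ne]
  by_cases h3 : y' = x
  · subst h3
    rw [← mk_subheap_bot_eq_top hc' hl']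
    refine .of_disjoint n (.two_top y' y hc hl) (.two_bot x' y' hc' hl') ?_ ?_
    · simp [h'.1.ne, (h'.1.trans h.1).ne]
    · simp [h.1.ne', (h'.1.trans h.1).ne']
  refine .of_disjoint n (.two_top x y hc hl) (.two_top x' y' hc' hl') ?_ ?_
  · simp [h3, Ne.symm h1]
  · simp [h2, h1]

/-- Comparability of concurrent elements shows that the middle of the triple is in neither position
of the pair, and that the tops differ. What remains is stacking, or chains whose top deletions do
not interfere. -/
theorem joinable_pair_triple (n : ℕ) {x y x' y' z' : E.carrier}
    (hc : E.IsConvexChain [x, y]) (hl : E.label x = E.label y)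
    (hc' : E.IsConvexChain [x', y', z']) (hl' : E.label x' = E.label z')
    (hne : E.label x' ≠ E.label y') :
    Joinable (n + 1, mk (E.subheap {y}ᶜ)) (n, mk (E.subheap {y', z'}ᶜ)) := by
  have h := isConvexChain_pair.1 hc
  obtain ⟨h1', h2', h3'⟩ := isConvexChain_triple.1 hc'
  have hr := rel_of_triple hc'
  have hx : x ≠ y' := by
    rintro rfl
    rcases E.comparable y z' (hl ▸ hr.2) with k | k
    · have : y ≠ z' := by rintro rfl; exact hne (hl'.trans hl.symm)
      exact h.1.ne' (h3' y (h1'.trans h.1) (lt_of_le_of_ne k this))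
    · have : z' ≠ y := by rintro rfl; exact hne (hl'.trans hl.symm)
      exact h.2 _ h2' (lt_of_le_of_ne k this)
  have hy : y ≠ y' := by
    rintro rfl
    rcases E.comparable x' x (hl ▸ hr.1) with k | k
    · have : x' ≠ x := by rintro rfl; exact hne hl
      exact h.1.ne (h3' x (lt_of_le_of_ne k this) (h.1.trans h2'))
    · have : x ≠ x' := by rintro rfl; exact hne hl
      exact h.2 _ (lt_of_le_of_ne k this) h1'
  have hz : y ≠ z' := by
    rintro rfl
    have hr1 := hr.2
    rw [← hl] at hr1
    rcases E.comparable y' x hr1 with k | k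
    · exact hx (h3' x (h1'.trans_le k) h.1)
    · exact h.2 _ (lt_of_le_of_ne k hx) h2'
  by_cases h1 : y = x'
  · subst h1
    rw [← mk_subheap_bot_eq_top hc hl]
    refine .of_disjoint n (.two_bot x y hc hl) (.three_top y y' z' hc' hl' hne) ?_ ?_
    · rw [Set.disjoint_left]; grind
    · rw [Set.disjoint_left]; grind
  by_cases h2 : x = z'
  · subst h2
    rw [← mk_subheap_triple_bot_eq_top hc' hl']
    refine .of_disjoint n (.two_top x y hc hl) (.three_bot x' y' x hc' hl' hne) ?_ ?_
    · rw [Set.disjoint_left]; grind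
    · rw [Set.disjoint_left]; grind
  refine .of_disjoint n (.two_top x y hc hl) (.three_top x' y' z' hc' hl' hne) ?_ ?_
  · rw [Set.disjoint_left]; grind
  · rw [Set.disjoint_left]; grind

/-- The two bottoms share a label, hence are comparable; if they differed, the higher one would be
the middle of the other chain, against the label condition. -/
theorem triple_bot_unique {x y z x' y' : E.carrier}
    (hc : E.IsConvexChain [x, y, z]) (hl : E.label x = E.label z)
    (hne : E.label x ≠ E.label y)
    (hc' : E.IsConvexChain [x', y', z]) (hl' : E.label x' = E.label z)
    (hne' : E.label x' ≠ E.label y') : x' = x ∧ y' = y := by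
  obtain ⟨h1, h2, h3⟩ := isConvexChain_triple.1 hc
  obtain ⟨h1', h2', h3'⟩ := isConvexChain_triple.1 hc'
  have hx : x' = x := by
    by_contra k
    rcases E.comparable x' x (by rw [hl, hl']; exact C.refl _) with h | h
    · exact hne' (hl'.trans (hl.symm.trans
        (congrArg _ (h3' x (lt_of_le_of_ne h k) (h1.trans h2)))))
    · exact hne (hl.trans (hl'.symm.trans
        (congrArg _ (h3 x' (lt_of_le_of_ne h (Ne.symm k)) (h1'.trans h2')))))
  subst hx
  exact ⟨rfl, h3 y' h1' h2'⟩

/-- If the middle of a balanced convex chain is the bottom of another one, then the two chains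
overlap in two elements. -/
theorem top_eq_mid {x y z y' z' : E.carrier}
    (hc : E.IsConvexChain [x, y, z]) (hl : E.label x = E.label z)
    (hne : E.label x ≠ E.label y)
    (hc' : E.IsConvexChain [y, y', z']) (hl' : E.label y = E.label z') : z = y' := by
  obtain ⟨h1, h2, h3⟩ := isConvexChain_triple.1 hc
  obtain ⟨h1', h2', h3'⟩ := isConvexChain_triple.1 hc'
  have hr := (rel_of_triple hc).2
  rw [hl'] at hr
  have hzz : z ≠ z' := by rintro rfl; exact hne (hl.trans hl'.symm)
  rcases E.comparable _ _ hr with k | k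
  · exact absurd (h3 z' (h1.trans (h1'.trans h2')) (lt_of_le_of_ne k hzz.symm))
      (h1'.trans h2').ne'
  · exact h3' z h2 (lt_of_le_of_ne k hzz)

/-- Order dual of `top_eq_mid`: here the middle of one chain is the top of the other. -/
theorem bot_eq_mid {x y z x' y' : E.carrier}
    (hc : E.IsConvexChain [x, y, z]) (hne : E.label x ≠ E.label y)
    (hc' : E.IsConvexChain [x', y', y]) (hl' : E.label x' = E.label y) : x = y' := by
  obtain ⟨h1, h2, h3⟩ := isConvexChain_triple.1 hc
  obtain ⟨h1', h2', h3'⟩ := isConvexChain_triple.1 hc'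
  have hr := (rel_of_triple hc).1
  rw [← hl'] at hr
  have hxx : x ≠ x' := by rintro rfl; exact hne hl'
  rcases E.comparable _ _ hr with k | k
  · exact absurd (h3 x' (lt_of_le_of_ne k hxx) ((h1'.trans h2').trans h2)) (h1'.trans h2').ne
  · exact h3' x (lt_of_le_of_ne k hxx.symm) h1

/-- Only `y` lay between `x'` and `z'`, so once `y` is gone they form a balanced pair, whose
contraction gives the factor `δ`. The deleted set is symmetric in `z` and `z'`, which closes the
common-middle case. -/
theorem Step.same_mid (n : ℕ) {x y z x' z' : E.carrier}
    (hc : E.IsConvexChain [x, y, z]) (hc' : E.IsConvexChain [x', y, z'])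
    (hl' : E.label x' = E.label z') (hz : z ≠ z') :
    Step (n, mk (E.subheap {y, z}ᶜ)) (n + 1, mk (E.subheap {y, z, z'}ᶜ)) := by
  obtain ⟨-, h2, -⟩ := isConvexChain_triple.1 hc
  obtain ⟨h1', h2', h3'⟩ := isConvexChain_triple.1 hc'
  obtain ⟨a, ha⟩ := exists_incl (E := E) (s := {y, z}ᶜ) (a := x')
    (by simp [h1'.ne, (h1'.trans h2).ne])
  obtain ⟨b, hb⟩ := exists_incl (E := E) (s := {y, z}ᶜ) (a := z') (by simp [h2'.ne', hz.symm])
  have hab : (E.subheap {y, z}ᶜ).label a = (E.subheap {y, z}ᶜ).label b := by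
    rw [← label_incl, ← label_incl, ha, hb, hl']
  have hch : (E.subheap {y, z}ᶜ).IsConvexChain [a, b] := by
    rw [isConvexChain_pair]
    refine ⟨lt_of_incl_lt (hab ▸ C.refl _) (by rw [ha, hb]; exact h1'.trans h2'), ?_⟩
    intro w k1 k2
    have := h3' _ (ha ▸ incl_strictMono k1) (hb ▸ incl_strictMono k2)
    exact incl_mem w (.inl this)
  convert Step.of_removable n (.two_top a b hch hab) using 2
  rw [mk_eq_mk.2 (subheap_subheap_iso _)]
  congr 2
  rw [← Set.range_sdiff_image incl_injective, range_incl, Set.image_singleton, hb]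
  ext w
  simp [and_assoc]

theorem joinable_triple_triple (n : ℕ) {x y z x' y' z' : E.carrier}
    (hc : E.IsConvexChain [x, y, z]) (hl : E.label x = E.label z)
    (hne : E.label x ≠ E.label y)
    (hc' : E.IsConvexChain [x', y', z']) (hl' : E.label x' = E.label z')
    (hne' : E.label x' ≠ E.label y') :
    Joinable (n, mk (E.subheap {y, z}ᶜ)) (n, mk (E.subheap {y', z'}ᶜ)) := by
  by_cases hz : z = z'
  · subst hz
    obtain ⟨rfl, rfl⟩ := triple_bot_unique hc hl hne hc' hl' hne'
    exact .of_eq rfl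
  by_cases hy : y = y'
  · subst hy
    refine ⟨_, .single (Step.same_mid n hc hc' hl' hz), .single ?_⟩
    rw [Set.pair_comm z z']
    exact Step.same_mid n hc' hc hl (Ne.symm hz)
  by_cases h1 : y = x'
  · subst h1
    -- The chains are now `x < y < z` and `y < z < z'`; deleting the top two of the first or the
    -- bottom two of the second removes the same set.
    obtain rfl := top_eq_mid hc hl hne hc' hl'
    rw [← mk_subheap_triple_bot_eq_top hc' hl']
    exact .of_eq rfl
  by_cases h2 : y' = x
  · subst h2
    obtain rfl := top_eq_mid hc' hl' hne' hc hl
    rw [← mk_subheap_triple_bot_eq_top hc hl]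
    exact .of_eq rfl
  have h3 : y ≠ z' := by
    rintro rfl
    exact h2 (bot_eq_mid hc hne hc' hl').symm
  have h4 : y' ≠ z := by
    rintro rfl
    exact h1 (bot_eq_mid hc' hne' hc hl).symm
  obtain ⟨k1, k2, -⟩ := isConvexChain_triple.1 hc
  obtain ⟨k1', k2', -⟩ := isConvexChain_triple.1 hc'
  by_cases h5 : x = z'
  · subst h5
    rw [← mk_subheap_triple_bot_eq_top hc' hl']
    refine .of_disjoint n (.three_top x y z hc hl hne) (.three_bot x' y' x hc' hl' hne') ?_ ?_
    · rw [Set.disjoint_left]; grind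
    · rw [Set.disjoint_left]; grind
  by_cases h6 : x' = z
  · subst h6
    rw [← mk_subheap_triple_bot_eq_top hc hl]
    refine .of_disjoint n (.three_bot x y x' hc hl hne) (.three_top x' y' z' hc' hl' hne') ?_ ?_
    · rw [Set.disjoint_left]; grind
    · rw [Set.disjoint_left]; grind
  refine .of_disjoint n (.three_top x y z hc hl hne) (.three_top x' y' z' hc' hl' hne') ?_ ?_
  · rw [Set.disjoint_left]; grind
  · rw [Set.disjoint_left]; grind

theorem Step.joinable {a b c : ℕ × Heap C} (hb : Step a b) (hc : Step a c) : Joinable b c := by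
  obtain ⟨n, ⟨E⟩⟩ := a
  rcases Step.exists_chain (E := E) hb with ⟨x, y, h1, h2, rfl⟩ | ⟨x, y, z, h1, h2, h3, rfl⟩ <;>
    rcases Step.exists_chain (E := E) hc with
      ⟨x', y', k1, k2, rfl⟩ | ⟨x', y', z', k1, k2, k3, rfl⟩
  · exact joinable_pair_pair n h1 h2 k1 k2
  · exact joinable_pair_triple n h1 h2 k1 k2 k3
  · exact (joinable_pair_triple n k1 k2 h1 h2 h3).symm
  · exact joinable_triple_triple n h1 h2 h3 k1 k2 k3

end Heap

/-! ### Reductions in context and unique normal forms -/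

namespace Heap

open LabelledHeap Relation

variable {P : Type u} {C : ConcurrencyRel P}

theorem Step.add_left (k : ℕ) {n m : ℕ} {h g : Heap C} (s : Step (n, h) (m, g)) :
    Step (k + n, h) (k + m, g) := by
  cases s with
  | two _ E x y hc hl => exact .two (k + n) E x y hc hl
  | three _ E x y z hc hl hne => exact .three (k + n) E x y z hc hl hne

theorem Step.mul_left {n m : ℕ} {h h' : Heap C} (s : Step (n, h) (m, h')) (g : Heap C) :
    Step (n, g * h) (m, g * h') := by
  obtain ⟨G⟩ := g
  cases s with
  | two _ E x y hc hl =>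
    exact (congrArg (Step _) (congrArg (Prod.mk _) (mk_eq_mk.2 (sup_contract_right_iso (E := G) (F := E) [x, y])))).mpr
      (Step.two n (sup G E) (.inr x) (.inr y) hc.inr hl)
  | three _ E x y z hc hl hne =>
    exact (congrArg (Step _) (congrArg (Prod.mk _) (mk_eq_mk.2 (sup_contract_right_iso (E := G) (F := E) [x, y, z])))).mpr
      (Step.three n (sup G E) (.inr x) (.inr y) (.inr z) hc.inr hl hne)

theorem Step.mul_right {n m : ℕ} {h h' : Heap C} (s : Step (n, h) (m, h')) (g : Heap C) :
    Step (n, h * g) (m, h' * g) := by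
  obtain ⟨G⟩ := g
  cases s with
  | two _ E x y hc hl =>
    exact (congrArg (Step _) (congrArg (Prod.mk _) (mk_eq_mk.2 (sup_contract_left_iso (E := E) (F := G) [x, y])))).mpr
      (Step.two n (sup E G) (.inl x) (.inl y) hc.inl hl)
  | three _ E x y z hc hl hne =>
    exact (congrArg (Step _) (congrArg (Prod.mk _) (mk_eq_mk.2 (sup_contract_left_iso (E := E) (F := G) [x, y, z])))).mpr
      (Step.three n (sup E G) (.inl x) (.inl y) (.inl z) hc.inl hl hne)

/-- Heaps with property P2 are irreducible. -/
theorem Step.not_hasP2 {n : ℕ} {h : Heap C} {p : ℕ × Heap C} (s : Step (n, h) p) :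
    ¬ h.HasP2 := by
  cases s with
  | two _ E x y hc hl => exact fun k : E.HasP2 => k.1 x y hc hl
  | three _ E x y z hc hl hne => exact fun k : E.HasP2 => k.2 x y z hc hl

/-- P2 also forbids triples with all labels equal, to which the second relation does not apply;
there the lower two elements form a balanced pair. -/
theorem exists_removable {E : LabelledHeap C} (h : ¬ E.HasP2) :
    ∃ c k D, E.Removable c k D ∧ D.Nonempty := by
  rw [LabelledHeap.HasP2, not_and_or] at h
  push Not at h
  rcases h with ⟨x, z, hc, hl⟩ | ⟨x, y, z, hc, hl⟩
  · exact ⟨_, _, _, .two_top x z hc hl, by simp⟩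
  · by_cases hne : E.label x = E.label y
    · refine ⟨_, _, _, .two_top x y ?_ hne, by simp⟩
      rw [isConvexChain_triple] at hc
      rw [isConvexChain_pair]
      exact ⟨hc.1, fun w h1 h2 => h2.ne (hc.2.2 w h1 (h2.trans hc.2.1))⟩
    · exact ⟨_, _, _, .three_top x y z hc hl hne, by simp⟩

theorem exists_normalForm (n : ℕ) (h : Heap C) :
    ∃ q : ℕ × {h : Heap C // h.HasP2}, ReflTransGen Step (n, h) (q.1, q.2.1) := by
  obtain ⟨E⟩ := h
  induction hm : Nat.card E.carrier using Nat.strong_induction_on generalizing E n with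
  | _ m ih =>
    by_cases hE : E.HasP2
    · exact ⟨(n, ⟨mk E, hE⟩), .refl⟩
    · obtain ⟨c, k, D, hD, a, ha⟩ := exists_removable hE
      have hlt : Nat.card (E.subheap Dᶜ).carrier < m := by
        subst hm
        exact Set.ncard_lt_card (s := Dᶜ) fun h => (h ▸ Set.mem_univ a : a ∈ Dᶜ) ha
      obtain ⟨q, hq⟩ := ih _ hlt (n + k) _ rfl
      exact ⟨q, .head (Step.of_removable n hD) hq⟩

/-- The normal form of `δ ^ n h`. -/
noncomputable def normalForm (p : ℕ × Heap C) : ℕ × {h : Heap C // h.HasP2} :=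
  (exists_normalForm p.1 p.2).choose

theorem normalForm_spec (p : ℕ × Heap C) :
    ReflTransGen Step p ((normalForm p).1, (normalForm p).2.1) :=
  (exists_normalForm p.1 p.2).choose_spec

theorem eq_of_reflTransGen {q : ℕ × {h : Heap C // h.HasP2}} {r : ℕ × Heap C}
    (h : ReflTransGen Step (q.1, q.2.1) r) : r = (q.1, q.2.1) := by
  rcases ReflTransGen.cases_head h with h | ⟨c, hc, -⟩
  · exact h.symm
  · exact (hc.not_hasP2 q.2.2).elim

theorem normalForm_eq {p : ℕ × Heap C} {q : ℕ × {h : Heap C // h.HasP2}}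
    (h : ReflTransGen Step p (q.1, q.2.1)) : normalForm p = q := by
  obtain ⟨r, h1, h2⟩ := church_rosser
    (fun a b c hb hc => by
      obtain ⟨d, k1, k2⟩ := Step.joinable hb hc
      exact ⟨d, k1, k2.to_reflTransGen⟩)
    (normalForm_spec p) h
  have := (eq_of_reflTransGen h1).symm.trans (eq_of_reflTransGen h2)
  rw [Prod.mk.injEq] at this
  exact Prod.ext this.1 (Subtype.ext this.2)

theorem normalForm_of_step {p q : ℕ × Heap C} (h : Step p q) : normalForm p = normalForm q :=
  normalForm_eq (.head h (normalForm_spec q))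

theorem normalForm_add (k n : ℕ) (h : Heap C) :
    normalForm (k + n, h) = (k + (normalForm (n, h)).1, (normalForm (n, h)).2) :=
  normalForm_eq (ReflTransGen.lift (fun p : ℕ × Heap C => (k + p.1, p.2))
    (fun _ _ s => Step.add_left k s) _ _ (normalForm_spec (n, h)))

theorem normalForm_of_hasP2 (n : ℕ) (h : {h : Heap C // h.HasP2}) :
    normalForm (n, h.1) = (n, h) :=
  normalForm_eq .refl

/-! ### Expansion map and descent to the quotient -/

/-- The expansion of a heap in the free module on the heaps with property P2. -/
noncomputable def expand (p : ℕ × Heap C) :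
    {h : Heap C // h.HasP2} →₀ LaurentPolynomial ℤ :=
  Finsupp.single (normalForm p).2 (heapDelta ^ (normalForm p).1)

theorem expand_one (h : Heap C) : expand (1, h) = heapDelta • expand (0, h) := by
  have := normalForm_add 1 0 h
  rw [add_zero] at this
  rw [expand, this, expand, Finsupp.smul_single, smul_eq_mul, ← pow_succ', add_comm 1]

/-- The linear extension of `expand`. -/
noncomputable def expandLinear : HeapAlgebra C →ₗ[LaurentPolynomial ℤ]
    ({h : Heap C // h.HasP2} →₀ LaurentPolynomial ℤ) :=
  Finsupp.linearCombination (LaurentPolynomial ℤ) (fun h : Heap C => expand (0, h)) ∘ₗ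
    (MonoidAlgebra.coeffLinearEquiv (LaurentPolynomial ℤ)).toLinearMap

theorem expandLinear_heapOf (h : Heap C) : expandLinear (heapOf h) = expand (0, h) := by
  simp [expandLinear, heapOf]

theorem heapOf_mul (g h : Heap C) : heapOf (g * h) = heapOf g * heapOf h :=
  map_mul _ _ _

/-- The congruence of the pairs with the same expansion in every context. -/
def expandCon (C : ConcurrencyRel P) : RingCon (HeapAlgebra C) where
  r a b := ∀ u w, expandLinear (u * a * w) = expandLinear (u * b * w)
  iseqv := ⟨fun _ _ _ => rfl, fun h u w => (h u w).symm, fun h k u w => (h u w).trans (k u w)⟩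
  add' h k u w := by simp only [mul_add, add_mul, map_add, h u w, k u w]
  mul' {a b c d} h k u w := by
    -- Replace one factor at a time, absorbing the other into the context.
    have h1 := h u (c * w)
    have h2 := k (u * b) w
    simp only [mul_assoc] at h1 h2 ⊢
    exact h1.trans h2

theorem expandCon_of_heaps {a b : HeapAlgebra C}
    (h : ∀ f g : Heap C, expandLinear (heapOf f * a * heapOf g) =
      expandLinear (heapOf f * b * heapOf g)) : expandCon C a b := by
  intro u w
  induction u using MonoidAlgebra.induction_on with
  | of f =>
    induction w using MonoidAlgebra.induction_on with
    | of g => exact h f g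
    | add x y hx hy => simp only [mul_add, map_add, hx, hy]
    | smul r x hx => simp only [mul_smul_comm, map_smul, hx]
  | add x y hx hy => simp only [add_mul, map_add, hx, hy]
  | smul r x hx => simp only [smul_mul_assoc, map_smul, hx]

theorem expandCon_of_heapRelation {a b : HeapAlgebra C} (h : HeapRelation C a b) :
    expandCon C a b := by
  refine expandCon_of_heaps fun f g => ?_
  cases h with
  | two E x y hc hb =>
    have := normalForm_of_step (((Step.two 0 E x y hc (by simpa [IsBalanced] using hb)).mul_left
      f).mul_right g)
    simp only [mul_smul_comm, smul_mul_assoc, map_smul, ← heapOf_mul, expandLinear_heapOf]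
    rw [← expand_one, expand, this, expand, zero_add]
  | three E x y z hc hb hne =>
    have := normalForm_of_step (((Step.three 0 E x y z hc (by simpa [IsBalanced] using hb)
      hne).mul_left f).mul_right g)
    simp only [← heapOf_mul, expandLinear_heapOf]
    rw [expand, this, expand]

/-- `expandLinear` is only linear, so it cannot be lifted to the ring quotient directly. The
quotient by `expandCon` is a ring in which the relations hold, so the map to it does lift; the
context `1, 1` then recovers `expandLinear`. -/
theorem expandLinear_eq_of_mkAlgHom_eq {a b : HeapAlgebra C}
    (h : RingQuot.mkAlgHom (LaurentPolynomial ℤ) (HeapRelation C) a =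
      RingQuot.mkAlgHom (LaurentPolynomial ℤ) (HeapRelation C) b) :
    expandLinear a = expandLinear b := by
  have hr : ∀ ⦃x y⦄, HeapRelation C x y → (expandCon C).mk' x = (expandCon C).mk' y :=
    fun _ _ k => (RingCon.eq _).2 (expandCon_of_heapRelation k)
  have key : ∀ x, RingQuot.lift ⟨(expandCon C).mk', hr⟩
      (RingQuot.mkAlgHom (LaurentPolynomial ℤ) (HeapRelation C) x) = (expandCon C).mk' x := by
    intro x
    have h1 : RingQuot.mkAlgHom (LaurentPolynomial ℤ) (HeapRelation C) x =
        RingQuot.mkRingHom (HeapRelation C) x := by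
      rw [← RingQuot.mkAlgHom_coe (LaurentPolynomial ℤ)]
      rfl
    rw [h1, RingQuot.lift_mkRingHom_apply]
  have h1 := (key a).symm.trans ((congrArg _ h).trans (key b))
  simpa using (RingCon.eq _).1 h1 1 1

/-! ### Independence and spanning -/

theorem linearIndependent_heapImage :
    LinearIndependent (LaurentPolynomial ℤ)
      fun h : {h : Heap C // h.HasP2} => heapImage h.1 := by
  have hE : ∀ l, Finsupp.linearCombination _
      (fun h : {h : Heap C // h.HasP2} => heapImage h.1) l =
      RingQuot.mkAlgHom (LaurentPolynomial ℤ) (HeapRelation C) (Finsupp.linearCombination _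
        (fun h : {h : Heap C // h.HasP2} => heapOf h.1) l) := fun l =>
    (Finsupp.apply_linearCombination _
      (RingQuot.mkAlgHom (LaurentPolynomial ℤ) (HeapRelation C)).toLinearMap _ l).symm
  -- A P2 heap is its own normal form with exponent `0`, so `expandLinear` is a left inverse on
  -- these combinations.
  have hL : ∀ l, expandLinear (Finsupp.linearCombination _
      (fun h : {h : Heap C // h.HasP2} => heapOf h.1) l) = l := by
    intro l
    rw [Finsupp.apply_linearCombination, Finsupp.linearCombination_apply]
    simp [expandLinear_heapOf, expand, normalForm_of_hasP2]
  intro l l' h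
  rw [hE, hE] at h
  rw [← hL l, ← hL l', expandLinear_eq_of_mkAlgHom_eq h]

theorem heapImage_of_step {p q : ℕ × Heap C} (s : Step p q) :
    heapDelta ^ p.1 • heapImage p.2 = heapDelta ^ q.1 • heapImage q.2 := by
  cases s with
  | two n E x y hc hl =>
    have := RingQuot.mkAlgHom_rel (LaurentPolynomial ℤ)
      (HeapRelation.two E x y hc (by simpa [IsBalanced] using hl))
    rw [map_smul] at this
    rw [pow_succ, mul_smul]
    exact congrArg _ this
  | three n E x y z hc hl hne =>
    exact congrArg _ (RingQuot.mkAlgHom_rel (LaurentPolynomial ℤ)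
      (HeapRelation.three E x y z hc (by simpa [IsBalanced] using hl) hne))

theorem heapImage_eq (h : Heap C) : heapImage h =
    heapDelta ^ (normalForm (0, h)).1 • heapImage (normalForm (0, h)).2.1 := by
  have : ∀ p q : ℕ × Heap C, ReflTransGen Step p q →
      heapDelta ^ p.1 • heapImage p.2 = heapDelta ^ q.1 • heapImage q.2 := by
    intro p q hpq
    induction hpq with
    | refl => rfl
    | tail _ s ih => exact ih.trans (heapImage_of_step s)
  simpa using this _ _ (normalForm_spec (0, h))

theorem span_heapImage : (⊤ : Submodule (LaurentPolynomial ℤ) (HeapQuotient C)) ≤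
    Submodule.span _ (Set.range fun h : {h : Heap C // h.HasP2} => heapImage h.1) := by
  rintro x -
  obtain ⟨a, rfl⟩ := RingQuot.mkAlgHom_surjective (LaurentPolynomial ℤ) (HeapRelation C) x
  induction a using MonoidAlgebra.induction_on with
  | of h =>
    change heapImage h ∈ _
    rw [heapImage_eq]
    exact Submodule.smul_mem _ _ (Submodule.subset_span ⟨_, rfl⟩)
  | add x y hx hy => rw [map_add]; exact Submodule.add_mem _ hx hy
  | smul r x hx => rw [map_smul]; exact Submodule.smul_mem _ _ hx

end Heap

theorem proposition3p2p2 {P : Type u} (C : ConcurrencyRel P) :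
    ∃ b : Module.Basis {h : Heap C // h.HasP2} (LaurentPolynomial ℤ) (HeapQuotient C),
      ∀ h : {h : Heap C // h.HasP2}, b h = heapImage h.1 :=
  ⟨.mk Heap.linearIndependent_heapImage Heap.span_heapImage,
    fun _ => Module.Basis.mk_apply _ _ _⟩
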